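/- Let $n \ge 1$. For $a,b \in [0,\infty]$, $\lambda \in [0,1]$ and $s \in [-\infty,+\infty]$ let $M_s^\lambda(a,b) = ((1-\lambda)a^s + \lambda b^s)^{1/s}$ if $s \notin \{-\infty,0,+\infty\}$, $M_{-\infty}^\lambda(a,b) = \min(a,b)$, $M_0^\lambda(a,b) = a^{1-\lambda}b^\lambda$ and $M_{+\infty}^\lambda(a,b) = \max(a,b)$ (with $0^s=+\infty$ for $s<0$ and $0\cdot\infty=0$). A convex body in $\mathbb R^n$ is a compact convex set with nonempty interior, it is symmetric if $K=-K$, and $h_K(u) = \max_{x\in K}\langle x,u\rangle$ is its support function. For $p \in [0,1]$ and symmetric convex bodies $K, L$ put $$(1-\lambda)\cdot K \oplus_p \lambda\cdot L = \{x\in\mathbb R^n : \langle x,u\rangle \le M_p^\lambda(h_K(u),h_L(u)) \text{ for all } u\in S^{n-1}\}.$$ A function $f:\mathbb R^n\to[0,\infty)$ is $\alpha$-concave if $f((1-\lambda)x+\lambda y)\ge M_\alpha^\lambda(f(x),f(y))$ for all $x,y$ with $f(x)f(y)>0$ and all $\lambda\in[0,1]$. A measure $\mu$ is symmetric if $\mu(-A)=\mu(A)$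 for every Borel set $A$. **Theorem.** Suppose that the log-Brunn–Minkowski inequality holds in $\mathbb R^n$, that is, $|(1-\lambda)\cdot K\oplus_0\lambda\cdot L| \ge |K|^{1-\lambda}|L|^\lambda$ for all symmetric convex bodies $K,L\subset\mathbb R^n$ and all $\lambda\in[0,1]$, where $|\cdot|$ is Lebesgue measure. Then $$\mu\big((1-\lambda)\cdot K \oplus_p \lambda\cdot L\big) \ge M^\lambda_{\left(\frac np+\frac1\alpha\right)^{-1}}\big(\mu(K),\mu(L)\big)$$ for every $p\in[0,1]$, every real $\alpha$ with $-\frac pn\le\alpha\le1$, every symmetric measure $\mu$ on $\mathbb R^n$ that has an $\alpha$-concave density with respect to Lebesgue measure, all symmetric convex bodies $K,L\subset\mathbb R^n$ and every $\lambda\in[0,1]$. Here $\left(\frac np+\frac1\alpha\right)^{-1}$ is read as $0$ if $p=0$ or $\alpha=0$, and as $-\infty$ if $p>0$ and $\alpha=-\frac pn$. -/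

import Mathlib

open MeasureTheory Set
open scoped ENNReal NNReal RealInnerProductSpace Pointwise

noncomputable section

/-- The `s`-mean `M_s^l(a, b)` with weight `l ∈ [0,1]` of `a, b ∈ [0, ∞]`, for `s ∈ [-∞, ∞]`.
The power function on `[0, ∞]` has `0 ^ s = ∞` for `s < 0`. -/
def powMean (s : EReal) (l : ℝ) (a b : ℝ≥0∞) : ℝ≥0∞ :=
  if s = ⊥ then min a b
  else if s = ⊤ then max a b
  else if s = 0 then a ^ (1 - l) * b ^ l
  else (ENNReal.ofReal (1 - l) * a ^ s.toReal + ENNReal.ofReal l * b ^ s.toReal) ^ (1 / s.toReal)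

/-- An origin-symmetric convex body in `ℝⁿ`: compact, convex, with nonempty interior, `-K = K`. -/
structure IsSymmConvexBody {n : ℕ} (K : Set (EuclideanSpace ℝ (Fin n))) : Prop where
  isCompact : IsCompact K
  convex : Convex ℝ K
  interior_nonempty : (interior K).Nonempty
  neg_eq : -K = K

/-- The support function `h_K(u) = max_{x ∈ K} ⟨x, u⟩`. -/
def suppFun {n : ℕ} (K : Set (EuclideanSpace ℝ (Fin n))) (u : EuclideanSpace ℝ (Fin n)) : ℝ :=
  sSup ((fun x => ⟪x, u⟫) '' K)

/-- The combination `(1-l)·K ⊕_p l·L`, i.e. the set of all `x` with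
`⟨x, u⟩ ≤ M_p^l(h_K(u), h_L(u))` for every unit vector `u`.  The support functions of symmetric
convex bodies are nonnegative, and the inequality is written in `[0, ∞]`: since the right-hand side
is nonnegative, replacing `⟨x, u⟩` by its positive part does not change it. -/
def lpComb {n : ℕ} (p l : ℝ) (K L : Set (EuclideanSpace ℝ (Fin n))) :
    Set (EuclideanSpace ℝ (Fin n)) :=
  {x | ∀ u : EuclideanSpace ℝ (Fin n), ‖u‖ = 1 →
    ENNReal.ofReal ⟪x, u⟫ ≤
      powMean (p : EReal) l (ENNReal.ofReal (suppFun K u)) (ENNReal.ofReal (suppFun L u))}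

/-- The log-Brunn–Minkowski inequality in `ℝⁿ`. -/
def LogBrunnMinkowski (n : ℕ) : Prop :=
  ∀ K L : Set (EuclideanSpace ℝ (Fin n)), IsSymmConvexBody K → IsSymmConvexBody L →
    ∀ l ∈ Icc (0 : ℝ) 1,
      volume K ^ (1 - l) * volume L ^ l ≤ volume (lpComb 0 l K L)

/-- `α`-concave functions `f : ℝⁿ → [0, ∞)`. -/
def IsAlphaConcave {n : ℕ} (α : EReal) (f : EuclideanSpace ℝ (Fin n) → ℝ≥0) : Prop :=
  ∀ x y : EuclideanSpace ℝ (Fin n), 0 < f x * f y → ∀ l ∈ Icc (0 : ℝ) 1,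
    powMean α l (f x) (f y) ≤ (f ((1 - l) • x + l • y) : ℝ≥0∞)

/-- The exponent `(n/p + 1/α)⁻¹` for `α ≥ -p/n`, extended by continuity: it is `0` if `p = 0` or
`α = 0`, and `-∞` if `p > 0` and `α = -p/n` (the limit as `α` decreases to `-p/n`). -/
def concExponent (n : ℕ) (p α : ℝ) : EReal :=
  if p = 0 ∨ α = 0 then 0
  else if (n : ℝ) / p + 1 / α = 0 then ⊥
  else (((n : ℝ) / p + 1 / α)⁻¹ : ℝ)

end

/-! The measure is sliced along superlevel sets of its density. Symmetry of `μ` makes `f` even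
almost everywhere, so `f` may be replaced by the even α-concave density `g x = min (f x) (f (-x))`,
whose sets `{g ≥ t}`, `t > 0`, are symmetric and convex. Let φ(t), ψ(t), h(t) be the volumes of the
parts of `K`, `L` and the `L_p` combination where `g ≥ t`; by layer cake, their integrals over `t >
0` are the three measures.

Rescaling the bodies to equal volume turns the log-Brunn–Minkowski inequality into the `L_p` one
with exponent `p/n` (`LogBrunnMinkowski.lp`). Since the `L_p` combination of two slices lies in
their Minkowski combination, where α-concavity bounds `g` from below, `superlevel_volume_le` gives
h(M_α(t,s)) ≥ M_{p/n}(φ(t), ψ(s)).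

The rest is one-dimensional (`realPowMean_integral_le_integral`). The ranges of `t` and `s` are cut
into `N` pieces of equal mass, and the i-th pieces are paired. The increment of M_α(t_i,s_i) is at
least M_α(Δt,Δs) by the reverse Minkowski inequality (`superadditive`, from `α ≤ 1`). `holder` (from
`α ≥ -p/n`) combines the exponents `p/n` and `α` into the final one. Each pair thus contributes
nearly 1/N of the desired mean; then N → ∞. -/

/-- The `s`-mean with weight `l` of two real numbers; the real-valued counterpart of `powMean`. -/
noncomputable def realPowMean (s : EReal) (l a b : ℝ) : ℝ :=
  if s = ⊥ then min a b
  else if s = ⊤ then max a b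
  else if s = 0 then a ^ (1 - l) * b ^ l
  else ((1 - l) * a ^ s.toReal + l * b ^ s.toReal) ^ (1 / s.toReal)

/-! ### Power means of positive reals: homogeneity, reverse Minkowski, Hölder. -/

namespace realPowMean

variable {s : EReal} {l a b c d x y : ℝ}

theorem bot : realPowMean ⊥ l a b = min a b := by simp [realPowMean]

theorem top : realPowMean ⊤ l a b = max a b := by simp [realPowMean]

theorem zero : realPowMean 0 l a b = a ^ (1 - l) * b ^ l := by simp [realPowMean]

theorem coe {r : ℝ} (hr : r ≠ 0) :
    realPowMean (r : EReal) l a b = ((1 - l) * a ^ r + l * b ^ r) ^ (1 / r) := by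
  simp [realPowMean, hr]

theorem exponent_cases (s : EReal) : s = ⊥ ∨ s = ⊤ ∨ s = 0 ∨ ∃ r : ℝ, r ≠ 0 ∧ s = r := by
  induction s with
  | bot => simp
  | top => simp
  | coe r =>
    by_cases h : r = 0
    · simp [h]
    · exact .inr (.inr (.inr ⟨r, h, rfl⟩))

theorem wsum_pos (hl : l ∈ Icc (0 : ℝ) 1) (ha : 0 < a) (hb : 0 < b) :
    0 < (1 - l) * a + l * b := by
  rcases hl.1.eq_or_lt with h | h
  · simp [← h, ha]
  · have := mul_nonneg (sub_nonneg.2 hl.2) ha.le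
    have := mul_pos h hb
    linarith

theorem pos (s : EReal) (hl : l ∈ Icc (0 : ℝ) 1) (ha : 0 < a) (hb : 0 < b) :
    0 < realPowMean s l a b := by
  obtain rfl | rfl | rfl | ⟨r, hr, rfl⟩ := exponent_cases s
  · simp [bot, ha, hb]
  · simp [top, ha]
  · rw [zero]; positivity
  · rw [coe hr]
    exact Real.rpow_pos_of_pos (wsum_pos hl (by positivity) (by positivity)) _

theorem coe_rpow {r : ℝ} (hr : r ≠ 0) (hl : l ∈ Icc (0 : ℝ) 1) (ha : 0 < a) (hb : 0 < b) :
    realPowMean (r : EReal) l a b ^ r = (1 - l) * a ^ r + l * b ^ r := by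
  rw [coe hr, ← Real.rpow_mul (wsum_pos hl (by positivity) (by positivity)).le,
    one_div_mul_cancel hr, Real.rpow_one]

theorem const (s : EReal) (ha : 0 < a) : realPowMean s l a a = a := by
  obtain rfl | rfl | rfl | ⟨r, hr, rfl⟩ := exponent_cases s
  · simp [bot]
  · simp [top]
  · rw [zero, ← Real.rpow_add ha]; simp
  · rw [coe hr, ← add_mul, sub_add_cancel, one_mul, ← Real.rpow_mul ha.le,
      mul_one_div_cancel hr, Real.rpow_one]

/-- Real powers satisfy `0 ^ r = 0` for negative `r` too, so no exponent is exceptional. The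
partitions below start at this pair. -/
theorem zero_zero (s : EReal) : realPowMean s l 0 0 = 0 := by
  obtain rfl | rfl | rfl | ⟨r, hr, rfl⟩ := exponent_cases s
  · simp [bot]
  · simp [top]
  · by_cases h : l = 0 <;> simp [zero, h]
  · simp [coe hr, Real.zero_rpow hr, Real.zero_rpow (inv_ne_zero hr)]

theorem smul (s : EReal) (hl : l ∈ Icc (0 : ℝ) 1) (hc : 0 < c) (ha : 0 < a) (hb : 0 < b) :
    realPowMean s l (c * a) (c * b) = c * realPowMean s l a b := by
  obtain rfl | rfl | rfl | ⟨r, hr, rfl⟩ := exponent_cases s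
  · simp [bot, mul_min_of_nonneg _ _ hc.le]
  · simp [top, mul_max_of_nonneg _ _ hc.le]
  · rw [zero, zero, Real.mul_rpow hc.le ha.le, Real.mul_rpow hc.le hb.le, mul_mul_mul_comm,
      ← Real.rpow_add hc]
    simp
  · rw [coe hr, coe hr, Real.mul_rpow hc.le ha.le, Real.mul_rpow hc.le hb.le,
      show (1 - l) * (c ^ r * a ^ r) + l * (c ^ r * b ^ r)
        = c ^ r * ((1 - l) * a ^ r + l * b ^ r) by ring,
      Real.mul_rpow (by positivity) (wsum_pos hl (by positivity) (by positivity)).le,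
      ← Real.rpow_mul hc.le, mul_one_div_cancel hr, Real.rpow_one]

theorem mono (s : EReal) (hl : l ∈ Icc (0 : ℝ) 1) (ha : 0 < a) (hb : 0 < b) (hac : a ≤ c)
    (hbd : b ≤ d) : realPowMean s l a b ≤ realPowMean s l c d := by
  have hl' := sub_nonneg.2 hl.2
  have hl0 := hl.1
  have hc := ha.trans_le hac
  have hd := hb.trans_le hbd
  obtain rfl | rfl | rfl | ⟨r, hr, rfl⟩ := exponent_cases s
  · simpa only [bot] using min_le_min hac hbd
  · simpa only [top] using max_le_max hac hbd
  · rw [zero, zero]; gcongr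
  · rw [coe hr, coe hr]
    rcases hr.lt_or_gt with h | h
    · refine Real.rpow_le_rpow_of_nonpos (wsum_pos hl (by positivity) (by positivity)) ?_
        (by simpa using h.le)
      have h1 := Real.rpow_le_rpow_of_nonpos ha hac h.le
      have h2 := Real.rpow_le_rpow_of_nonpos hb hbd h.le
      gcongr
    · exact Real.rpow_le_rpow (wsum_pos hl (by positivity) (by positivity)).le (by gcongr)
        (by positivity)

theorem ofReal_eq (s : EReal) (hl : l ∈ Icc (0 : ℝ) 1) (ha : 0 < a) (hb : 0 < b) :
    powMean s l (ENNReal.ofReal a) (ENNReal.ofReal b) = ENNReal.ofReal (realPowMean s l a b) := by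
  have hl' := sub_nonneg.2 hl.2
  have hl0 := hl.1
  obtain rfl | rfl | rfl | ⟨r, hr, rfl⟩ := exponent_cases s
  · simp [powMean, bot]
  · simp [powMean, top]
  · simp [powMean, zero, ENNReal.ofReal_rpow_of_pos ha, ENNReal.ofReal_rpow_of_pos hb,
      ← ENNReal.ofReal_mul (Real.rpow_nonneg ha.le _)]
  · rw [coe hr, ← ENNReal.ofReal_rpow_of_pos (wsum_pos hl (by positivity) (by positivity)),
      ENNReal.ofReal_add (by positivity) (by positivity), ENNReal.ofReal_mul hl',
      ENNReal.ofReal_mul hl0, ← ENNReal.ofReal_rpow_of_pos ha, ← ENNReal.ofReal_rpow_of_pos hb]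
    simp [powMean, hr]

/-- A homogeneous inequality for positive numbers may be checked on the level set `1`. -/
theorem self_div (s : EReal) (hl : l ∈ Icc (0 : ℝ) 1) (ha : 0 < a) (hb : 0 < b) :
    realPowMean s l (a / realPowMean s l a b) (b / realPowMean s l a b) = 1 := by
  have h := pos s hl ha hb
  rw [div_eq_inv_mul, div_eq_inv_mul, smul s hl (inv_pos.2 h) ha hb, inv_mul_cancel₀ h.ne']

theorem one_le_coe {r : ℝ} (hr : 0 < r) (h : 1 ≤ (1 - l) * a ^ r + l * b ^ r) :
    1 ≤ realPowMean (r : EReal) l a b := by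
  rw [coe hr.ne']
  exact Real.one_le_rpow h (by positivity)

theorem one_le_coe_of_neg {r : ℝ} (hr : r < 0) (hl : l ∈ Icc (0 : ℝ) 1) (ha : 0 < a) (hb : 0 < b)
    (h : (1 - l) * a ^ r + l * b ^ r ≤ 1) : 1 ≤ realPowMean (r : EReal) l a b := by
  rw [coe hr.ne]
  exact Real.one_le_rpow_of_pos_of_le_one_of_nonpos
    (wsum_pos hl (by positivity) (by positivity)) h (by simpa using hr.le)

theorem coe_le_one {r : ℝ} (hr : 0 < r) (hl : l ∈ Icc (0 : ℝ) 1) (ha : 0 < a) (hb : 0 < b)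
    (h : (1 - l) * a ^ r + l * b ^ r ≤ 1) : realPowMean (r : EReal) l a b ≤ 1 := by
  rw [coe hr.ne']
  exact Real.rpow_le_one (wsum_pos hl (by positivity) (by positivity)).le h (by positivity)

theorem coe_le_one_of_neg {r : ℝ} (hr : r < 0) (h : 1 ≤ (1 - l) * a ^ r + l * b ^ r) :
    realPowMean (r : EReal) l a b ≤ 1 := by
  rw [coe hr.ne]
  exact Real.rpow_le_one_of_one_le_of_nonpos h (by simpa using hr.le)

theorem wsum_eq_one {r : ℝ} (hr : r ≠ 0) (hl : l ∈ Icc (0 : ℝ) 1) (ha : 0 < a) (hb : 0 < b)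
    (h : realPowMean (r : EReal) l a b = 1) : (1 - l) * a ^ r + l * b ^ r = 1 := by
  rw [← coe_rpow hr hl ha hb, h, Real.one_rpow]

/-- AM-GM is used twice: a negative power reverses it for `x, z`, and it then applies to `x ^ r, z ^
r`. -/
theorem _root_.Real.rpow_convex_of_neg {r w x z : ℝ} (hr : r < 0) (hw : w ∈ Icc (0 : ℝ) 1)
    (hx : 0 < x) (hz : 0 < z) :
    ((1 - w) * x + w * z) ^ r ≤ (1 - w) * x ^ r + w * z ^ r := by
  have hw' := sub_nonneg.2 hw.2
  have h1 := Real.geom_mean_le_arith_mean2_weighted hw' hw.1 hx.le hz.le (by ring)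
  have h2 := Real.geom_mean_le_arith_mean2_weighted hw' hw.1 (Real.rpow_nonneg hx.le r)
    (Real.rpow_nonneg hz.le r) (by ring)
  refine (Real.rpow_le_rpow_of_nonpos (by positivity) h1 hr.le).trans (le_of_eq_of_le ?_ h2)
  rw [Real.mul_rpow (by positivity) (by positivity), ← Real.rpow_mul hx.le, ← Real.rpow_mul hz.le,
    ← Real.rpow_mul hx.le, ← Real.rpow_mul hz.le]
  ring_nf

/-- Superlevel sets of the `r`-mean, `r ≤ 1`, are convex. -/
theorem one_le_convexComb {r w : ℝ} (hr : r ≤ 1) (hl : l ∈ Icc (0 : ℝ) 1)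
    (hw : w ∈ Icc (0 : ℝ) 1) (ha : 0 < a) (hb : 0 < b) (hc : 0 < c) (hd : 0 < d)
    (hab : realPowMean (r : EReal) l a b = 1) (hcd : realPowMean (r : EReal) l c d = 1) :
    1 ≤ realPowMean (r : EReal) l ((1 - w) * a + w * c) ((1 - w) * b + w * d) := by
  have hl' := sub_nonneg.2 hl.2
  have hl0 := hl.1
  have hw' := sub_nonneg.2 hw.2
  have hw0 := hw.1
  rcases lt_trichotomy r 0 with h | rfl | h
  · have h1 := wsum_eq_one h.ne hl ha hb hab
    have h2 := wsum_eq_one h.ne hl hc hd hcd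
    refine one_le_coe_of_neg h hl (wsum_pos hw ha hc) (wsum_pos hw hb hd) ?_
    calc _ ≤ (1 - l) * ((1 - w) * a ^ r + w * c ^ r) + l * ((1 - w) * b ^ r + w * d ^ r) := by
          gcongr <;> exact Real.rpow_convex_of_neg h hw (by assumption) (by assumption)
      _ = 1 := by linear_combination (1 - w) * h1 + w * h2
  · simp only [EReal.coe_zero, zero] at *
    calc (1 : ℝ) = (a ^ (1 - l) * b ^ l) ^ (1 - w) * (c ^ (1 - l) * d ^ l) ^ w := by
          simp [hab, hcd]
      _ = (a ^ (1 - w) * c ^ w) ^ (1 - l) * (b ^ (1 - w) * d ^ w) ^ l := by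
          simp only [Real.mul_rpow (Real.rpow_nonneg ha.le _) (Real.rpow_nonneg hb.le _),
            Real.mul_rpow (Real.rpow_nonneg hc.le _) (Real.rpow_nonneg hd.le _),
            Real.mul_rpow (Real.rpow_nonneg ha.le _) (Real.rpow_nonneg hc.le _),
            Real.mul_rpow (Real.rpow_nonneg hb.le _) (Real.rpow_nonneg hd.le _),
            ← Real.rpow_mul ha.le, ← Real.rpow_mul hb.le, ← Real.rpow_mul hc.le,
            ← Real.rpow_mul hd.le]
          ring_nf
      _ ≤ _ := by
          gcongr
          · exact Real.geom_mean_le_arith_mean2_weighted hw' hw0 ha.le hc.le (by ring)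
          · exact Real.geom_mean_le_arith_mean2_weighted hw' hw0 hb.le hd.le (by ring)
  · have h1 := wsum_eq_one h.ne' hl ha hb hab
    have h2 := wsum_eq_one h.ne' hl hc hd hcd
    refine one_le_coe h ?_
    have key : ∀ {x z : ℝ}, 0 < x → 0 < z →
        (1 - w) * x ^ r + w * z ^ r ≤ ((1 - w) * x + w * z) ^ r := fun {x z} hx hz =>
      (Real.concaveOn_rpow h.le hr).2 hx.le hz.le hw' hw0 (by ring)
    calc (1 : ℝ) = (1 - l) * ((1 - w) * a ^ r + w * c ^ r) + l * ((1 - w) * b ^ r + w * d ^ r) := by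
          linear_combination -(1 - w) * h1 - w * h2
      _ ≤ _ := by gcongr <;> exact key (by assumption) (by assumption)

/-- The reverse Minkowski inequality. -/
theorem superadditive {r : ℝ} (hr : r ≤ 1) (hl : l ∈ Icc (0 : ℝ) 1)
    (ha : 0 < a) (hb : 0 < b) (hc : 0 < c) (hd : 0 < d) :
    realPowMean (r : EReal) l a b + realPowMean (r : EReal) l c d
      ≤ realPowMean (r : EReal) l (a + c) (b + d) := by
  set u := realPowMean (r : EReal) l a b with hu
  set v := realPowMean (r : EReal) l c d with hv
  have hu0 : 0 < u := pos _ hl ha hb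
  have hv0 : 0 < v := pos _ hl hc hd
  -- Both pairs are scaled to mean 1; with this weight their convex combination is the sum of the
  -- pairs divided by `u + v`, and homogeneity finishes.
  have h := one_le_convexComb (w := v / (u + v)) hr hl
    ⟨by positivity, div_le_one_of_le₀ (by linarith) (by positivity)⟩
    (div_pos ha hu0) (div_pos hb hu0) (div_pos hc hv0) (div_pos hd hv0)
    (self_div _ hl ha hb) (self_div _ hl hc hd)
  have e : ∀ x z : ℝ, x + z = (u + v) * ((1 - v / (u + v)) * (x / u) + v / (u + v) * (z / v)) := by
    intro x z
    field_simp
    ring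
  have e' : ∀ {x z : ℝ}, 0 < x → 0 < z →
      0 < (1 - v / (u + v)) * (x / u) + v / (u + v) * (z / v) := by
    intro x z hx hz
    have := e x z
    exact pos_of_mul_pos_right (this ▸ add_pos hx hz) (by positivity)
  rw [e a c, e b d, smul _ hl (by positivity) (e' ha hc) (e' hb hd)]
  exact le_mul_of_one_le_right (by positivity) h

/-- AM-GM for `a ^ r, b ^ r` bounds the `r`-th power of the geometric mean by 1. -/
theorem zero_le_one {r : ℝ} (hr : 0 ≤ r) (hl : l ∈ Icc (0 : ℝ) 1) (ha : 0 < a) (hb : 0 < b)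
    (h : realPowMean (r : EReal) l a b = 1) : a ^ (1 - l) * b ^ l ≤ 1 := by
  rcases hr.eq_or_lt with rfl | hr
  · simpa [zero] using h.le
  · have h1 := Real.geom_mean_le_arith_mean2_weighted (sub_nonneg.2 hl.2) hl.1
      (Real.rpow_nonneg ha.le r) (Real.rpow_nonneg hb.le r) (by ring)
    rw [wsum_eq_one hr.ne' hl ha hb h, ← Real.rpow_mul ha.le, ← Real.rpow_mul hb.le,
      mul_comm r, mul_comm r, Real.rpow_mul ha.le, Real.rpow_mul hb.le,
      ← Real.mul_rpow (by positivity) (by positivity)] at h1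
    exact (Real.rpow_le_one_iff_of_pos (by positivity)).1 h1 |>.elim (fun h => by linarith [h.2])
      (fun h => h.1)

/-- Bernoulli's inequality for `(B / A) ^ (1 + m)`, multiplied by `A`. It replaces Young's
inequality when one of the two weights is negative. -/
theorem _root_.Real.reverse_young {A B m : ℝ} (hA : 0 < A) (hB : 0 < B) (hm : 0 ≤ m) :
    (1 + m) * B - m * A ≤ A ^ (-m) * B ^ (1 + m) := by
  have h := one_add_mul_self_le_rpow_one_add (s := B / A - 1)
    (by have := div_pos hB hA; linarith) (p := 1 + m) (by linarith)
  have h2 := mul_le_mul_of_nonneg_left h hA.le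
  calc _ = A * (1 + (1 + m) * (B / A - 1)) := by field_simp; ring
    _ ≤ _ := h2
    _ = A ^ (-m) * B ^ (1 + m) := by
      rw [add_sub_cancel, Real.div_rpow hB.le hA.le, Real.rpow_neg hA.le, Real.rpow_add hA,
        Real.rpow_one]
      field_simp

/-- With `q = p / n`, Young's inequality with weights `α / (q + α)` and `q / (q + α)` is applied to
each of the two products and averaged with weights `1 - l, l`; both normalizations then sum to 1.
The cases where the final exponent is 0 or `⊥` are separate. -/
theorem holder_normalized {n : ℕ} (hn : 0 < n) {p α : ℝ} (hp : 0 ≤ p) (hα : -(p / n) ≤ α)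
    (hl : l ∈ Icc (0 : ℝ) 1) (ha : 0 < a) (hb : 0 < b) (hx : 0 < x) (hy : 0 < y)
    (hab : realPowMean ((p / n : ℝ) : EReal) l a b = 1)
    (hxy : realPowMean (α : EReal) l x y = 1) :
    realPowMean (concExponent n p α) l (a * x) (b * y) ≤ 1 := by
  have hn' : (0 : ℝ) < n := by exact_mod_cast hn
  have hl' := sub_nonneg.2 hl.2
  have hl0 := hl.1
  by_cases h0 : p = 0 ∨ α = 0
  · have hα0 : 0 ≤ α := by
      rcases h0 with rfl | rfl
      · simpa using hα
      · exact le_rfl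
    rw [concExponent, if_pos h0, zero, Real.mul_rpow ha.le hx.le, Real.mul_rpow hb.le hy.le,
      mul_mul_mul_comm]
    exact mul_le_one₀ (zero_le_one (by positivity) hl ha hb hab) (by positivity)
      (zero_le_one hα0 hl hx hy hxy)
  obtain ⟨hp0, hα0⟩ := not_or.1 h0
  have hp' : 0 < p := lt_of_le_of_ne hp (Ne.symm hp0)
  set q : ℝ := p / n with hq
  have hq0 : 0 < q := by positivity
  have hnp : (n : ℝ) / p = 1 / q := by rw [hq, one_div_div]
  have h1 := wsum_eq_one hq0.ne' hl ha hb hab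
  have h2 := wsum_eq_one hα0 hl hx hy hxy
  by_cases hbot : (n : ℝ) / p + 1 / α = 0
  · have hαq : α = -q := by
      rw [hnp] at hbot
      field_simp at hbot
      linarith
    rw [concExponent, if_neg h0, if_pos hbot, bot]
    by_contra! hlt
    obtain ⟨hax, hby⟩ := lt_min_iff.1 hlt
    -- If both products exceeded 1, the average of `x ^ α, y ^ α` would be strictly below that of `a
    -- ^ q, b ^ q`, but both are 1.
    have key : ∀ {c z : ℝ}, 0 < c → 0 < z → 1 < c * z → z ^ α < c ^ q := by
      intro c z hc hz h
      rw [hαq, Real.rpow_neg hz.le, ← Real.inv_rpow hz.le]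
      exact Real.rpow_lt_rpow (by positivity) ((inv_lt_iff_one_lt_mul₀ hz).2 h) hq0
    have := wsum_pos hl (sub_pos.2 (key ha hx hax)) (sub_pos.2 (key hb hy hby))
    linarith
  · have hqα : 0 < q + α := by
      refine lt_of_le_of_ne (by linarith) fun h => hbot ?_
      rw [hnp, show α = -q by linarith]
      field_simp
      ring
    rw [concExponent, if_neg h0, if_neg hbot, hnp]
    have hγ : (1 / q + 1 / α)⁻¹ = q * α / (q + α) := by
      rw [div_add_div _ _ hq0.ne' hα0, inv_div, one_mul, mul_one, add_comm]
    rw [hγ]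
    set γ := q * α / (q + α) with hγ'
    have e : ∀ {c z : ℝ}, 0 < c → 0 < z →
        (c * z) ^ γ = (c ^ q) ^ (α / (q + α)) * (z ^ α) ^ (q / (q + α)) := by
      intro c z hc hz
      rw [Real.mul_rpow hc.le hz.le, ← Real.rpow_mul hc.le, ← Real.rpow_mul hz.le, hγ']
      congr 2 <;> ring
    have hsum : α / (q + α) + q / (q + α) = 1 := by
      rw [← add_div, add_comm, div_self hqα.ne']
    rcases lt_or_gt_of_ne hα0 with hneg | hpos
    -- For `α < 0` the weight `α / (q + α)` is negative, so Young reverses; the final power `1 / γ`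
    -- is negative and restores the direction.
    · have hγ0 : γ < 0 := div_neg_of_neg_of_pos (mul_neg_of_pos_of_neg hq0 hneg) hqα
      have key : ∀ {c z : ℝ}, 0 < c → 0 < z →
          α / (q + α) * c ^ q + q / (q + α) * z ^ α ≤ (c * z) ^ γ := by
        intro c z hc hz
        have h := Real.reverse_young (A := c ^ q) (B := z ^ α) (m := -(α / (q + α)))
          (by positivity) (by positivity) (by
            rw [neg_nonneg]; exact div_nonpos_of_nonpos_of_nonneg hneg.le hqα.le)
        rw [neg_neg, show 1 + -(α / (q + α)) = q / (q + α) by linarith, ← e hc hz] at h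
        linarith
      refine coe_le_one_of_neg hγ0 ?_
      calc (1 : ℝ) = (1 - l) * (α / (q + α) * a ^ q + q / (q + α) * x ^ α)
            + l * (α / (q + α) * b ^ q + q / (q + α) * y ^ α) := by
            linear_combination -hsum - α / (q + α) * h1 - q / (q + α) * h2
        _ ≤ _ := by gcongr <;> exact key (by assumption) (by assumption)
    · have key : ∀ {c z : ℝ}, 0 < c → 0 < z →
          (c * z) ^ γ ≤ α / (q + α) * c ^ q + q / (q + α) * z ^ α := by
        intro c z hc hz
        rw [e hc hz]
        exact Real.geom_mean_le_arith_mean2_weighted (by positivity) (by positivity)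
          (by positivity) (by positivity) hsum
      refine coe_le_one (by positivity) hl (by positivity) (by positivity) ?_
      calc (1 - l) * (a * x) ^ γ + l * (b * y) ^ γ
          ≤ (1 - l) * (α / (q + α) * a ^ q + q / (q + α) * x ^ α)
            + l * (α / (q + α) * b ^ q + q / (q + α) * y ^ α) := by
            gcongr <;> exact key (by assumption) (by assumption)
        _ = 1 := by linear_combination hsum + α / (q + α) * h1 + q / (q + α) * h2

/-- The generalized Hölder inequality for power means. -/
theorem holder {n : ℕ} (hn : 0 < n) {p α : ℝ} (hp : 0 ≤ p) (hα : -(p / n) ≤ α)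
    (hl : l ∈ Icc (0 : ℝ) 1) (ha : 0 < a) (hb : 0 < b) (hx : 0 < x) (hy : 0 < y) :
    realPowMean (concExponent n p α) l (a * x) (b * y)
      ≤ realPowMean ((p / n : ℝ) : EReal) l a b * realPowMean (α : EReal) l x y := by
  set u := realPowMean ((p / n : ℝ) : EReal) l a b with hu
  set v := realPowMean (α : EReal) l x y with hv
  have hu0 : 0 < u := pos _ hl ha hb
  have hv0 : 0 < v := pos _ hl hx hy
  have h := holder_normalized hn hp hα hl (div_pos ha hu0) (div_pos hb hu0) (div_pos hx hv0)
    (div_pos hy hv0) (self_div _ hl ha hb) (self_div _ hl hx hy)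
  have e : ∀ c z : ℝ, c * z = (u * v) * (c / u * (z / v)) := by
    intro c z
    field_simp
  rw [e a x, e b y, smul _ hl (by positivity) (by positivity) (by positivity)]
  exact mul_le_of_le_one_right (by positivity) h

/-- The mean increases by at least the smaller of the two ratios. -/
theorem min_ratio_mul_le (s : EReal) (hl : l ∈ Icc (0 : ℝ) 1) (ha : 0 < a) (hb : 0 < b)
    (hc : 0 < c) (hd : 0 < d) :
    min (c / a) (d / b) * realPowMean s l a b ≤ realPowMean s l c d := by
  have hm : 0 < min (c / a) (d / b) := lt_min (by positivity) (by positivity)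
  rw [← smul s hl hm ha hb]
  exact mono s hl (by positivity) (by positivity) ((le_div_iff₀ ha).1 (min_le_left _ _))
    ((le_div_iff₀ hb).1 (min_le_right _ _))

end realPowMean

/-! ### Equal-mass partitions and the one-dimensional Borell–Brascamp–Lieb inequality. -/

namespace Antitone

variable {φ ψ h : ℝ → ℝ}

theorem mul_sub_le_intervalIntegral (hφ : Antitone φ) {a b : ℝ} (hab : a ≤ b) :
    φ b * (b - a) ≤ ∫ x in a..b, φ x := by
  have := intervalIntegral.integral_mono_on hab (intervalIntegrable_const (c := φ b))
    (hφ.intervalIntegrable (μ := volume)) (fun x hx => hφ hx.2)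
  simpa [mul_comm] using this

theorem intervalIntegral_le_mul_sub (hφ : Antitone φ) {a b : ℝ} (hab : a ≤ b) :
    ∫ x in a..b, φ x ≤ φ a * (b - a) := by
  have := intervalIntegral.integral_mono_on hab (hφ.intervalIntegrable (μ := volume))
    (intervalIntegrable_const (c := φ a)) (fun x hx => hφ hx.1)
  simpa [mul_comm] using this

theorem intervalIntegral_add (hφ : Antitone φ) (a b c : ℝ) :
    (∫ x in a..b, φ x) + ∫ x in b..c, φ x = ∫ x in a..c, φ x :=
  intervalIntegral.integral_add_adjacent_intervals hφ.intervalIntegrable hφ.intervalIntegrable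

theorem continuous_primitive (hφ : Antitone φ) : Continuous fun x => ∫ y in (0 : ℝ)..x, φ y :=
  intervalIntegral.continuous_primitive (fun _ _ => hφ.intervalIntegrable) 0

/-- A partition of `[0, τ]` into pieces of equal mass; the lower Riemann sum misses on each piece
a part of the mass controlled by the drop of `φ`. -/
theorem exists_equal_mass_partition (hφ : Antitone φ) {τ : ℝ} (hτ : 0 < τ) (hφτ : 0 < φ τ)
    {N : ℕ} (hN : 0 < N) :
    ∃ t : ℕ → ℝ, t 0 = 0 ∧ (∀ i ≤ N, t i ≤ τ) ∧ (∀ i < N, t i < t (i + 1)) ∧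
      ∀ i < N, 1 - (φ (t i) - φ (t (i + 1))) / φ τ
        ≤ φ (t (i + 1)) * (t (i + 1) - t i) / ((∫ x in (0 : ℝ)..τ, φ x) / N) := by
  set F : ℝ → ℝ := fun x => ∫ y in (0 : ℝ)..x, φ y with hF
  have hN' : (0 : ℝ) < N := by exact_mod_cast hN
  have hA : 0 < F τ := (mul_pos hφτ (sub_pos.2 hτ)).trans_le (hφ.mul_sub_le_intervalIntegral hτ.le)
  have hF0 : F 0 = 0 := by simp [hF]
  have hex : ∀ i : ℕ, ∃ x, i ≤ N → x ∈ Icc 0 τ ∧ F x = i * (F τ / N) := by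
    intro i
    by_cases hi : i ≤ N
    · have hi' : (i : ℝ) ≤ N := by exact_mod_cast hi
      have hmem : (i : ℝ) * (F τ / N) ∈ Icc (F 0) (F τ) := by
        rw [hF0]
        refine ⟨by positivity, ?_⟩
        calc (i : ℝ) * (F τ / N) ≤ N * (F τ / N) := by gcongr
          _ = F τ := by field_simp
      obtain ⟨x, hx, hx'⟩ := intermediate_value_Icc hτ.le
        (hφ.continuous_primitive.continuousOn) hmem
      exact ⟨x, fun _ => ⟨hx, hx'⟩⟩
    · exact ⟨0, fun h => absurd h hi⟩
  choose t ht using hex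
  have hmono : ∀ {x y : ℝ}, y ≤ x → x ≤ τ → F y ≤ F x := by
    intro x y hxy hx
    have h1 := hφ.intervalIntegral_add 0 y x
    have h2 := hφ.mul_sub_le_intervalIntegral hxy
    have h3 := mul_nonneg (hφτ.le.trans (hφ hx)) (sub_nonneg.2 hxy)
    simp only [hF]
    linarith
  have hpos : 0 < F τ / N := by positivity
  have hlt : ∀ i < N, t i < t (i + 1) := by
    intro i hi
    by_contra! hle
    have h1 := ht i hi.le
    have h2 := ht (i + 1) hi
    have h3 := hmono hle h1.1.2
    rw [h1.2, h2.2] at h3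
    push_cast at h3
    linarith
  refine ⟨t, ?_, fun i hi => (ht i hi).1.2, hlt, ?_⟩
  · obtain ⟨h1, h2⟩ := ht 0 N.zero_le
    by_contra hne
    have h0 : 0 < t 0 := lt_of_le_of_ne h1.1 (Ne.symm hne)
    have h3 := hφ.mul_sub_le_intervalIntegral h0.le
    have h4 := mul_pos (hφτ.trans_le (hφ h1.2)) (sub_pos.2 h0)
    simp only [hF] at h2
    rw [h2] at h3
    simp only [Nat.cast_zero, zero_mul] at h3
    linarith
  · intro i hi
    obtain ⟨h1, h2⟩ := ht i hi.le
    obtain ⟨h3, h4⟩ := ht (i + 1) hi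
    have hle := (hlt i hi).le
    have hmass : ∫ x in t i..t (i + 1), φ x = F τ / N := by
      have := hφ.intervalIntegral_add 0 (t i) (t (i + 1))
      simp only [hF] at h2 h4 ⊢
      push_cast at h4
      linarith
    -- The mass `F τ / N` of a piece is at most its upper rectangle, which exceeds the lower one by
    -- drop times width; the width is at most the mass divided by `φ τ`.
    have h5 := hφ.mul_sub_le_intervalIntegral hle
    have h6 := hφ.intervalIntegral_le_mul_sub hle
    rw [hmass] at h5 h6
    have hΔ : 0 ≤ t (i + 1) - t i := sub_nonneg.2 hle
    have h7 : φ τ * (t (i + 1) - t i) ≤ F τ / N :=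
      (mul_le_mul_of_nonneg_right (hφ h3.2) hΔ).trans h5
    have hd : 0 ≤ φ (t i) - φ (t (i + 1)) := sub_nonneg.2 (hφ hle)
    rw [le_div_iff₀ hpos]
    have h8 : (φ (t i) - φ (t (i + 1))) * (t (i + 1) - t i)
        ≤ (φ (t i) - φ (t (i + 1))) / φ τ * (F τ / N) := by
      rw [div_mul_eq_mul_div, le_div_iff₀ hφτ, mul_assoc]
      gcongr
      linarith
    linarith

end Antitone

/-- A one-dimensional Borell–Brascamp–Lieb inequality for antitone functions on `(0, ∞)`, with
power means of different exponents in the variable and in the value. -/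
theorem realPowMean_integral_le_integral {n : ℕ} (hn : 0 < n) {p α l : ℝ} (hp : 0 ≤ p)
    (hα : -(p / n) ≤ α) (hα' : α ≤ 1) (hl : l ∈ Icc (0 : ℝ) 1) {φ ψ h : ℝ → ℝ}
    (hφ : Antitone φ) (hψ : Antitone ψ) (hh : Antitone h) (hφ0 : ∀ t, 0 ≤ φ t)
    (hψ0 : ∀ t, 0 ≤ ψ t) (hh0 : ∀ t, 0 ≤ h t)
    (hmean : ∀ t s, 0 < t → 0 < s → 0 < φ t → 0 < ψ s →
      realPowMean ((p / n : ℝ) : EReal) l (φ t) (ψ s) ≤ h (realPowMean (α : EReal) l t s))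
    {τ σ : ℝ} (hτ : 0 < τ) (hσ : 0 < σ) (hφτ : 0 < φ τ) (hψσ : 0 < ψ σ) :
    realPowMean (concExponent n p α) l (∫ t in (0 : ℝ)..τ, φ t) (∫ s in (0 : ℝ)..σ, ψ s)
      ≤ ∫ r in (0 : ℝ)..realPowMean (α : EReal) l τ σ, h r := by
  set A := ∫ t in (0 : ℝ)..τ, φ t with hA
  set B := ∫ s in (0 : ℝ)..σ, ψ s with hB
  set M := realPowMean (concExponent n p α) l A B with hM
  set R := realPowMean (α : EReal) l τ σ with hR
  have hA0 : 0 < A := (mul_pos hφτ (sub_pos.2 hτ)).trans_le (hφ.mul_sub_le_intervalIntegral hτ.le)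
  have hB0 : 0 < B := (mul_pos hψσ (sub_pos.2 hσ)).trans_le (hψ.mul_sub_le_intervalIntegral hσ.le)
  have hM0 : 0 < M := realPowMean.pos _ hl hA0 hB0
  -- The error collects the drops of φ and ψ over all pieces; they telescope to bounds independent
  -- of `N`, while each carries a factor `M / N`.
  have key : ∀ N : ℕ, 0 < N →
      M - M * (φ 0 / φ τ + ψ 0 / ψ σ) / N ≤ ∫ r in (0 : ℝ)..R, h r := by
    intro N hN
    have hN' : (0 : ℝ) < N := by exact_mod_cast hN
    obtain ⟨t, ht0, htτ, htlt, htφ⟩ := hφ.exists_equal_mass_partition hτ hφτ hN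
    obtain ⟨s, hs0, hsσ, hslt, hsψ⟩ := hψ.exists_equal_mass_partition hσ hψσ hN
    have htpos : ∀ i < N, 0 < t (i + 1) := by
      intro i hi
      induction i with
      | zero => simpa [ht0] using htlt 0 hi
      | succ i ih => exact (ih (by omega)).trans (htlt _ hi)
    have hspos : ∀ i < N, 0 < s (i + 1) := by
      intro i hi
      induction i with
      | zero => simpa [hs0] using hslt 0 hi
      | succ i ih => exact (ih (by omega)).trans (hslt _ hi)
    set r : ℕ → ℝ := fun i => realPowMean (α : EReal) l (t i) (s i) with hr
    have hr0 : r 0 = 0 := by simp only [hr, ht0, hs0, realPowMean.zero_zero]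
    have hstep : ∀ i < N, M / N * (1 - (φ (t i) - φ (t (i + 1))) / φ τ
        - (ψ (s i) - ψ (s (i + 1))) / ψ σ) ≤ ∫ x in r i..r (i + 1), h x := by
      intro i hi
      have hΔt := sub_pos.2 (htlt i hi)
      have hΔs := sub_pos.2 (hslt i hi)
      have hφi : 0 < φ (t (i + 1)) := hφτ.trans_le (hφ (htτ _ hi))
      have hψi : 0 < ψ (s (i + 1)) := hψσ.trans_le (hψ (hsσ _ hi))
      have hΔr : realPowMean (α : EReal) l (t (i + 1) - t i) (s (i + 1) - s i)
          ≤ r (i + 1) - r i := by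
        -- Superadditivity is available for positive entries only; at `i = 0` both partitions start
        -- at 0 and equality holds.
        rcases Nat.eq_zero_or_pos i with rfl | hi0
        · rw [hr0, ht0, hs0, sub_zero, sub_zero, sub_zero]
        · obtain ⟨j, rfl⟩ := Nat.exists_eq_succ_of_ne_zero hi0.ne'
          have := realPowMean.superadditive hα' hl (htpos j (by omega)) (hspos j (by omega))
            hΔt hΔs
          simp only [add_sub_cancel] at this
          simp only [hr, Nat.succ_eq_add_one] at this ⊢
          linarith
      have hmpos := realPowMean.pos (α : EReal) hl hΔt hΔs
      have hle : r i ≤ r (i + 1) := by linarith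
      have hmin : 1 - (φ (t i) - φ (t (i + 1))) / φ τ - (ψ (s i) - ψ (s (i + 1))) / ψ σ
          ≤ min (φ (t (i + 1)) * (t (i + 1) - t i) / (A / N))
            (ψ (s (i + 1)) * (s (i + 1) - s i) / (B / N)) := by
        have h1 : 0 ≤ (φ (t i) - φ (t (i + 1))) / φ τ :=
          div_nonneg (sub_nonneg.2 (hφ (htlt i hi).le)) hφτ.le
        have h2 : 0 ≤ (ψ (s i) - ψ (s (i + 1))) / ψ σ :=
          div_nonneg (sub_nonneg.2 (hψ (hslt i hi).le)) hψσ.le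
        exact le_min (by linarith [htφ i hi]) (by linarith [hsψ i hi])
      have hMN : realPowMean (concExponent n p α) l (A / N) (B / N) = M / N := by
        rw [div_eq_inv_mul, div_eq_inv_mul, realPowMean.smul _ hl (by positivity) hA0 hB0,
          ← div_eq_inv_mul]
      calc _ ≤ M / N * min (φ (t (i + 1)) * (t (i + 1) - t i) / (A / N))
            (ψ (s (i + 1)) * (s (i + 1) - s i) / (B / N)) := by gcongr
        _ ≤ realPowMean (concExponent n p α) l (φ (t (i + 1)) * (t (i + 1) - t i))
            (ψ (s (i + 1)) * (s (i + 1) - s i)) := by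
            rw [mul_comm, ← hMN]
            exact realPowMean.min_ratio_mul_le _ hl (by positivity) (by positivity)
              (by positivity) (by positivity)
        _ ≤ realPowMean ((p / n : ℝ) : EReal) l (φ (t (i + 1))) (ψ (s (i + 1)))
            * realPowMean (α : EReal) l (t (i + 1) - t i) (s (i + 1) - s i) :=
            realPowMean.holder hn hp hα hl hφi hψi hΔt hΔs
        _ ≤ h (r (i + 1)) * (r (i + 1) - r i) := by
            gcongr
            · exact hh0 _
            · exact hmean _ _ (htpos i hi) (hspos i hi) hφi hψi
        _ ≤ _ := hh.mul_sub_le_intervalIntegral hle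
    have hsum := Finset.sum_le_sum fun i hi => hstep i (Finset.mem_range.1 hi)
    rw [intervalIntegral.sum_integral_adjacent_intervals
      (fun k _ => hh.intervalIntegrable (μ := volume)), hr0, ← Finset.mul_sum,
      Finset.sum_sub_distrib, Finset.sum_sub_distrib, ← Finset.sum_div, ← Finset.sum_div,
      Finset.sum_range_sub' (fun i => φ (t i)), Finset.sum_range_sub' (fun i => ψ (s i)), ht0,
      hs0] at hsum
    simp only [Finset.sum_const, Finset.card_range, nsmul_eq_mul, mul_one] at hsum
    have hrR : r N ≤ R := by
      obtain ⟨j, rfl⟩ := Nat.exists_eq_succ_of_ne_zero hN.ne'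
      exact realPowMean.mono _ hl (htpos j (by omega)) (hspos j (by omega)) (htτ _ le_rfl)
        (hsσ _ le_rfl)
    have hlast : ∫ x in (0 : ℝ)..r N, h x ≤ ∫ x in (0 : ℝ)..R, h x := by
      have h1 := hh.intervalIntegral_add 0 (r N) R
      have h2 := hh.mul_sub_le_intervalIntegral hrR
      have h3 := mul_nonneg (hh0 R) (sub_nonneg.2 hrR)
      linarith
    refine (le_trans ?_ hsum).trans hlast
    calc M - M * (φ 0 / φ τ + ψ 0 / ψ σ) / N = M / N * (N - φ 0 / φ τ - ψ 0 / ψ σ) := by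
          field_simp
          ring
      _ ≤ _ := by
          gcongr <;> linarith [hφ0 (t N), hψ0 (s N)]
  have hlim : Filter.Tendsto (fun N : ℕ => M - M * (φ 0 / φ τ + ψ 0 / ψ σ) / N) Filter.atTop
      (nhds M) := by
    simpa using (tendsto_const_nhds (x := M)).sub
      (tendsto_const_div_atTop_nhds_zero_nat (M * (φ 0 / φ τ + ψ 0 / ψ σ)))
  exact le_of_tendsto hlim (Filter.eventually_atTop.2 ⟨1, fun N hN => key N hN⟩)

/-! ### Comparison of exponents and two facts on convex sets. -/

namespace realPowMean

variable {l a b : ℝ}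

theorem zero_le_coe {r : ℝ} (hr : 0 ≤ r) (hl : l ∈ Icc (0 : ℝ) 1) (ha : 0 < a) (hb : 0 < b) :
    realPowMean 0 l a b ≤ realPowMean (r : EReal) l a b := by
  set u := realPowMean (r : EReal) l a b with hu
  have hu0 : 0 < u := pos _ hl ha hb
  have h := zero_le_one hr hl (div_pos ha hu0) (div_pos hb hu0) (self_div _ hl ha hb)
  rw [← zero, div_eq_inv_mul, div_eq_inv_mul, smul _ hl (inv_pos.2 hu0) ha hb] at h
  exact (inv_mul_le_one₀ hu0).1 h

theorem le_arith {p : ℝ} (hp : p ∈ Icc (0 : ℝ) 1) (hl : l ∈ Icc (0 : ℝ) 1) (ha : 0 < a)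
    (hb : 0 < b) : realPowMean (p : EReal) l a b ≤ (1 - l) * a + l * b := by
  have hl' := sub_nonneg.2 hl.2
  rcases hp.1.eq_or_lt with rfl | h0
  · rw [EReal.coe_zero, zero]
    exact Real.geom_mean_le_arith_mean2_weighted hl' hl.1 ha.le hb.le (by ring)
  · rw [coe h0.ne']
    have h := (convexOn_rpow (one_le_one_div h0 hp.2)).2 (Real.rpow_nonneg ha.le p)
      (Real.rpow_nonneg hb.le p) hl' hl.1 (by ring)
    simp only [smul_eq_mul] at h
    rwa [← Real.rpow_mul ha.le, ← Real.rpow_mul hb.le, mul_one_div_cancel h0.ne', Real.rpow_one,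
      Real.rpow_one] at h

end realPowMean

theorem Convex.zero_mem_interior_of_neg_eq {E : Type*} [NormedAddCommGroup E] [NormedSpace ℝ E]
    {K : Set E} (hK : Convex ℝ K) (hneg : -K = K) (hne : (interior K).Nonempty) :
    (0 : E) ∈ interior K := by
  obtain ⟨x, hx⟩ := hne
  have hx' : -x ∈ interior K := by
    have h : -interior K ⊆ interior K :=
      interior_maximal ((neg_subset_neg.2 interior_subset).trans hneg.subset) isOpen_interior.neg
    exact h (by simpa using hx)
  have := hK.interior hx hx' (a := 1 / 2) (b := 1 / 2) (by norm_num) (by norm_num) (by norm_num)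
  simpa using this

/-- With empty interior, the set would lie in its own frontier, which is null for a convex set. -/
theorem Convex.interior_nonempty_of_volume_ne_zero {n : ℕ} {S : Set (EuclideanSpace ℝ (Fin n))}
    (hS : Convex ℝ S) (h : volume S ≠ 0) : (interior S).Nonempty := by
  by_contra hne
  rw [not_nonempty_iff_eq_empty] at hne
  refine h (measure_mono_null ?_ (hS.addHaar_frontier volume))
  rw [frontier, hne, sdiff_empty]
  exact subset_closure

/-! ### Symmetric convex bodies, `L_p` combinations, and passage from log to `L_p`. -/

section Bodies

variable {n : ℕ} {K L K' L' : Set (EuclideanSpace ℝ (Fin n))} {u x : EuclideanSpace ℝ (Fin n)}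
  {p l c : ℝ}

theorem le_suppFun (hK : IsCompact K) (hx : x ∈ K) : ⟪x, u⟫ ≤ suppFun K u :=
  le_csSup (hK.image (by fun_prop)).bddAbove (mem_image_of_mem _ hx)

theorem suppFun_mono (hK : K.Nonempty) (hK' : IsCompact K') (h : K ⊆ K') :
    suppFun K u ≤ suppFun K' u :=
  csSup_le (hK.image _) (by rintro _ ⟨y, hy, rfl⟩; exact le_suppFun hK' (h hy))

theorem suppFun_smul (hc : 0 ≤ c) : suppFun (c • K) u = c * suppFun K u := by
  rw [suppFun, suppFun, ← smul_eq_mul, ← Real.sSup_smul_of_nonneg hc]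
  congr 1
  ext r
  simp [mem_smul_set, real_inner_smul_left]

namespace IsSymmConvexBody

theorem zero_mem_interior (hK : IsSymmConvexBody K) : 0 ∈ interior K :=
  hK.convex.zero_mem_interior_of_neg_eq hK.neg_eq hK.interior_nonempty

theorem nonempty (hK : IsSymmConvexBody K) : K.Nonempty := ⟨0, interior_subset hK.zero_mem_interior⟩

theorem suppFun_pos (hK : IsSymmConvexBody K) (hu : ‖u‖ = 1) : 0 < suppFun K u := by
  obtain ⟨ε, hε, hball⟩ := Metric.isOpen_iff.1 isOpen_interior 0 hK.zero_mem_interior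
  have hmem : (ε / 2) • u ∈ K := by
    refine interior_subset (hball ?_)
    rw [mem_ball_zero_iff, norm_smul, hu, mul_one, Real.norm_of_nonneg (by positivity)]
    linarith
  have h := le_suppFun (u := u) hK.isCompact hmem
  rw [real_inner_smul_left, real_inner_self_eq_norm_sq, hu] at h
  linarith

theorem volume_ne_zero (hK : IsSymmConvexBody K) : volume K ≠ 0 :=
  (Measure.measure_pos_of_nonempty_interior volume hK.interior_nonempty).ne'

theorem volume_ne_top (hK : IsSymmConvexBody K) : volume K ≠ ⊤ := hK.isCompact.measure_lt_top.ne

theorem volume_toReal_pos (hK : IsSymmConvexBody K) : 0 < (volume K).toReal :=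
  ENNReal.toReal_pos hK.volume_ne_zero hK.volume_ne_top

theorem smul (hK : IsSymmConvexBody K) (hc : c ≠ 0) : IsSymmConvexBody (c • K) where
  isCompact := hK.isCompact.smul c
  convex := hK.convex.smul c
  interior_nonempty := by
    rw [interior_smul₀ hc]
    exact hK.interior_nonempty.smul_set
  neg_eq := by rw [← smul_set_neg, hK.neg_eq]

theorem volume_smul_toReal (hc : 0 ≤ c) :
    (volume (c • K)).toReal = c ^ n * (volume K).toReal := by
  rw [Measure.addHaar_smul, finrank_euclideanSpace_fin, ENNReal.toReal_mul,
    ENNReal.toReal_ofReal (abs_nonneg _), abs_of_nonneg (pow_nonneg hc n)]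

end IsSymmConvexBody

theorem mem_lpComb_iff (hK : IsSymmConvexBody K) (hL : IsSymmConvexBody L)
    (hl : l ∈ Icc (0 : ℝ) 1) :
    x ∈ lpComb p l K L ↔
      ∀ u, ‖u‖ = 1 → ⟪x, u⟫ ≤ realPowMean (p : EReal) l (suppFun K u) (suppFun L u) := by
  refine forall₂_congr fun u hu => ?_
  have h1 := hK.suppFun_pos hu
  have h2 := hL.suppFun_pos hu
  rw [realPowMean.ofReal_eq _ hl h1 h2,
    ENNReal.ofReal_le_ofReal_iff (realPowMean.pos _ hl h1 h2).le]

theorem isClosed_lpComb : IsClosed (lpComb p l K L) := by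
  simp only [lpComb, ofPred_forall]
  refine isClosed_iInter fun u => isClosed_iInter fun _ => isClosed_le ?_ continuous_const
  exact ENNReal.continuous_ofReal.comp (by fun_prop)

theorem lpComb_mono (hK : IsSymmConvexBody K) (hL : IsSymmConvexBody L)
    (hK' : IsSymmConvexBody K') (hL' : IsSymmConvexBody L') (hl : l ∈ Icc (0 : ℝ) 1)
    (hKK' : K ⊆ K') (hLL' : L ⊆ L') : lpComb p l K L ⊆ lpComb p l K' L' := by
  intro x hx
  rw [mem_lpComb_iff hK hL hl] at hx
  rw [mem_lpComb_iff hK' hL' hl]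
  exact fun u hu => (hx u hu).trans (realPowMean.mono _ hl (hK.suppFun_pos hu) (hL.suppFun_pos hu)
    (suppFun_mono hK.nonempty hK'.isCompact hKK') (suppFun_mono hL.nonempty hL'.isCompact hLL'))

/-- For `p ≤ 1` the `L_p` combination is contained in the Minkowski combination. -/
theorem lpComb_subset_add (hK : IsSymmConvexBody K) (hL : IsSymmConvexBody L)
    (hp : p ∈ Icc (0 : ℝ) 1) (hl : l ∈ Icc (0 : ℝ) 1) :
    lpComb p l K L ⊆ (1 - l) • K + l • L := by
  intro x hx
  rw [mem_lpComb_iff hK hL hl] at hx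
  by_contra hnot
  obtain ⟨f, w, hf, hw⟩ := geometric_hahn_banach_closed_point
    ((hK.convex.smul (1 - l)).add (hL.convex.smul l))
    ((hK.isCompact.smul (1 - l)).add (hL.isCompact.smul l)).isClosed hnot
  obtain ⟨v, rfl⟩ := (InnerProductSpace.toDual ℝ (EuclideanSpace ℝ (Fin n))).surjective f
  simp only [InnerProductSpace.toDual_apply_apply] at hf hw
  have hv : v ≠ 0 := by
    rintro rfl
    obtain ⟨a, ha⟩ := hK.nonempty
    obtain ⟨b, hb⟩ := hL.nonempty
    have := hf _ (add_mem_add (smul_mem_smul_set ha) (smul_mem_smul_set hb))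
    simp only [inner_zero_left] at this hw
    linarith
  have hv0 : 0 < ‖v‖ := norm_pos_iff.2 hv
  -- `lpComb` tests unit vectors only, so the separating functional is normalized. In that direction
  -- the support functions are attained, at points whose combination violates the separation.
  have hu : ‖‖v‖⁻¹ • v‖ = 1 := by rw [norm_smul, norm_inv, norm_norm, inv_mul_cancel₀ hv0.ne']
  have hattain : ∀ {S : Set (EuclideanSpace ℝ (Fin n))}, IsSymmConvexBody S →
      ∃ a ∈ S, suppFun S (‖v‖⁻¹ • v) = ⟪a, ‖v‖⁻¹ • v⟫ := by
    intro S hS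
    obtain ⟨a, ha, h⟩ := (hS.isCompact.image
      (f := fun x => ⟪x, ‖v‖⁻¹ • v⟫) (by fun_prop)).sSup_mem (hS.nonempty.image _)
    exact ⟨a, ha, h.symm⟩
  obtain ⟨a, ha, hKa⟩ := hattain hK
  obtain ⟨b, hb, hLb⟩ := hattain hL
  have h1 := hf _ (add_mem_add (smul_mem_smul_set ha) (smul_mem_smul_set hb))
  have h2 := (hx _ hu).trans
    (realPowMean.le_arith hp hl (hK.suppFun_pos hu) (hL.suppFun_pos hu))
  rw [hKa, hLb] at h2
  simp only [real_inner_smul_right, inner_add_right] at h1 h2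
  rw [real_inner_comm] at hw
  rw [real_inner_comm, real_inner_comm b] at h1
  have h3 : ‖v‖⁻¹ * ⟪x, v⟫ ≤ ‖v‖⁻¹ * ((1 - l) * ⟪a, v⟫ + l * ⟪b, v⟫) := by linarith
  have h4 := le_of_mul_le_mul_left h3 (inv_pos.2 hv0)
  linarith

/-- The log-Brunn–Minkowski inequality implies the `L_p`-Brunn–Minkowski inequality. -/
theorem LogBrunnMinkowski.lp (hlog : LogBrunnMinkowski n) (hn : 0 < n) (hp : 0 ≤ p)
    (hl : l ∈ Icc (0 : ℝ) 1) (hK : IsSymmConvexBody K) (hL : IsSymmConvexBody L) :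
    ENNReal.ofReal (realPowMean ((p / n : ℝ) : EReal) l (volume K).toReal (volume L).toReal)
      ≤ volume (lpComb p l K L) := by
  have hlog' : ∀ {θ : ℝ} {S T : Set (EuclideanSpace ℝ (Fin n))}, θ ∈ Icc (0 : ℝ) 1 →
      IsSymmConvexBody S → IsSymmConvexBody T →
      ENNReal.ofReal (realPowMean 0 θ (volume S).toReal (volume T).toReal)
        ≤ volume (lpComb 0 θ S T) := by
    intro θ S T hθ hS hT
    rw [← realPowMean.ofReal_eq 0 hθ hS.volume_toReal_pos hT.volume_toReal_pos,
      ENNReal.ofReal_toReal hS.volume_ne_top, ENNReal.ofReal_toReal hT.volume_ne_top]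
    simpa [powMean] using hlog S T hS hT θ hθ
  rcases hp.eq_or_lt with rfl | hp
  · simpa using hlog' hl hK hL
  have hn' : (0 : ℝ) < n := by exact_mod_cast hn
  set k := (volume K).toReal with hk
  set m := (volume L).toReal with hm
  set q : ℝ := p / n with hq
  have hq0 : 0 < q := by positivity
  have hk0 : 0 < k := hK.volume_toReal_pos
  have hm0 : 0 < m := hL.volume_toReal_pos
  -- The factors `(D / k ^ q) ^ (1 / p)` and `(D / m ^ q) ^ (1 / p)` give both bodies the volume `D
  -- ^ (1 / q)`, which is the wanted mean. The weight `θ` undoes the scaling: `1 - θ` times the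
  -- `p`-th power of the first scaled support function is `1 - l` times the original one, and
  -- likewise for `θ` and `l`.
  set D := (1 - l) * k ^ q + l * m ^ q with hD
  have hD0 : 0 < D := realPowMean.wsum_pos hl (by positivity) (by positivity)
  set θ := l * m ^ q / D with hθ
  have hl' := sub_nonneg.2 hl.2
  have hl0 := hl.1
  have hθ1 : 1 - θ = (1 - l) * k ^ q / D := by
    rw [hθ, eq_div_iff hD0.ne', sub_mul, div_mul_cancel₀ _ hD0.ne', hD]
    ring
  have hθmem : θ ∈ Icc (0 : ℝ) 1 :=
    ⟨by positivity, sub_nonneg.1 (hθ1 ▸ by positivity)⟩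
  have hpow : ∀ z : ℝ, 0 < z → ((D / z ^ q) ^ (1 / p)) ^ p = D / z ^ q := by
    intro z hz
    rw [← Real.rpow_mul (by positivity), one_div_mul_cancel hp.ne', Real.rpow_one]
  have hvol : ∀ z : ℝ, 0 < z → ((D / z ^ q) ^ (1 / p)) ^ n * z = D ^ (1 / q) := by
    intro z hz
    rw [← Real.rpow_natCast, ← Real.rpow_mul (by positivity), one_div_mul_eq_div,
      Real.div_rpow hD0.le (by positivity), ← Real.rpow_mul hz.le, hq, one_div_div,
      show p / n * (n / p) = 1 by field_simp, Real.rpow_one, div_mul_cancel₀ _ hz.ne']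
  have hK' := hK.smul (c := (D / k ^ q) ^ (1 / p)) (by positivity)
  have hL' := hL.smul (c := (D / m ^ q) ^ (1 / p)) (by positivity)
  have h := hlog' hθmem hK' hL'
  rw [IsSymmConvexBody.volume_smul_toReal (by positivity),
    IsSymmConvexBody.volume_smul_toReal (by positivity), ← hk, ← hm, hvol k hk0, hvol m hm0,
    realPowMean.const _ (by positivity)] at h
  rw [realPowMean.coe hq0.ne']
  refine h.trans (measure_mono fun x hx => ?_)
  have hx' := (mem_lpComb_iff (p := 0) hK' hL' hθmem).1 hx
  refine (mem_lpComb_iff hK hL hl).2 fun u hu => (hx' u hu).trans ?_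
  have ha := hK.suppFun_pos hu
  have hb := hL.suppFun_pos hu
  rw [suppFun_smul (by positivity), suppFun_smul (by positivity), EReal.coe_zero]
  refine (realPowMean.zero_le_coe hp.le hθmem (by positivity) (by positivity)).trans_eq ?_
  rw [realPowMean.coe hp.ne', realPowMean.coe hp.ne', Real.mul_rpow (by positivity) ha.le,
    Real.mul_rpow (by positivity) hb.le, hpow k hk0, hpow m hm0, hθ1, hθ]
  congr 1
  field_simp

end Bodies

/-! ### Degenerate means, truncation of the mass, null frontiers. -/

theorem powMean_zero_zero (s : EReal) {l : ℝ} (hl : l ∈ Icc (0 : ℝ) 1) : powMean s l 0 0 = 0 := by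
  obtain rfl | rfl | rfl | ⟨r, hr, rfl⟩ := realPowMean.exponent_cases s
  · simp [powMean]
  · simp [powMean]
  · rcases hl.1.eq_or_lt with rfl | h
    · simp [powMean]
    · simp [powMean, h]
  · simp only [powMean, EReal.coe_ne_bot, EReal.coe_ne_top, EReal.coe_eq_zero, hr, if_false,
      EReal.toReal_coe]
    rcases lt_or_gt_of_ne hr with h | h
    · rw [ENNReal.zero_rpow_of_neg h, ← add_mul, ← ENNReal.ofReal_add (sub_nonneg.2 hl.2) hl.1]
      simp [h]
    · rw [ENNReal.zero_rpow_of_pos h]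
      simp [h]

/-- Stopping strictly before the full mass keeps `φ τ` positive: otherwise φ would contribute
nothing after `τ`. -/
theorem Antitone.exists_intervalIntegral_eq_mul {φ : ℝ → ℝ} (hφ : Antitone φ)
    (hφ0 : ∀ t, 0 ≤ φ t) {T θ : ℝ} (hT : 0 ≤ T) (hA : 0 < ∫ t in (0 : ℝ)..T, φ t)
    (hθ : θ ∈ Ioo (0 : ℝ) 1) :
    ∃ τ, 0 < τ ∧ 0 < φ τ ∧ ∫ t in (0 : ℝ)..τ, φ t = θ * ∫ t in (0 : ℝ)..T, φ t := by
  have hθA := mul_pos hθ.1 hA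
  obtain ⟨τ, ⟨h0, hτT⟩, hτ⟩ := intermediate_value_Icc hT hφ.continuous_primitive.continuousOn
    (show θ * ∫ t in (0 : ℝ)..T, φ t ∈ _ by
      rw [intervalIntegral.integral_same]
      exact ⟨hθA.le, mul_le_of_le_one_left hA.le hθ.2.le⟩)
  simp only at hτ
  refine ⟨τ, lt_of_le_of_ne h0 ?_, lt_of_le_of_ne (hφ0 τ) ?_, hτ⟩
  · rintro rfl
    rw [intervalIntegral.integral_same] at hτ
    exact hθA.ne hτ
  · intro h
    have h1 := hφ.intervalIntegral_add 0 τ T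
    have h2 := hφ.intervalIntegral_le_mul_sub hτT
    rw [← h, zero_mul] at h2
    have := mul_lt_of_lt_one_left hA hθ.2
    linarith

theorem Convex.volume_closure_inter_le {n : ℕ} {A S : Set (EuclideanSpace ℝ (Fin n))}
    (hS : Convex ℝ S) : volume (A ∩ closure S) ≤ volume (A ∩ S) := by
  have h : A ∩ closure S ⊆ (A ∩ S) ∪ frontier S := by
    rintro x ⟨hx, hx'⟩
    rw [closure_eq_self_union_frontier] at hx'
    exact hx'.elim (fun h => .inl ⟨hx, h⟩) .inr
  calc _ ≤ volume ((A ∩ S) ∪ frontier S) := measure_mono h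
    _ ≤ volume (A ∩ S) + volume (frontier S) := measure_union_le _ _
    _ = _ := by rw [hS.addHaar_frontier volume, add_zero]

/-! ### Superlevel sets of the density and the layer-cake argument. -/

section Superlevel

variable {n : ℕ} {K L C : Set (EuclideanSpace ℝ (Fin n))} {f g : EuclideanSpace ℝ (Fin n) → ℝ≥0}
  {x y : EuclideanSpace ℝ (Fin n)} {p l t s α : ℝ}

theorem isAlphaConcave_iff {β : EReal} : IsAlphaConcave β g ↔
    ∀ x y, 0 < (g x : ℝ) → 0 < (g y : ℝ) → ∀ l ∈ Icc (0 : ℝ) 1,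
      realPowMean β l (g x) (g y) ≤ g ((1 - l) • x + l • y) := by
  have key : ∀ x y, 0 < (g x : ℝ) → 0 < (g y : ℝ) → ∀ l ∈ Icc (0 : ℝ) 1,
      (powMean β l (g x) (g y) ≤ (g ((1 - l) • x + l • y) : ℝ≥0∞) ↔
        realPowMean β l (g x) (g y) ≤ g ((1 - l) • x + l • y)) := by
    intro x y hx hy l hl
    rw [← ENNReal.ofReal_coe_nnreal, ← ENNReal.ofReal_coe_nnreal, ← ENNReal.ofReal_coe_nnreal,
      realPowMean.ofReal_eq _ hl hx hy, ENNReal.ofReal_le_ofReal_iff (NNReal.coe_nonneg _)]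
  constructor
  · intro h x y hx hy l hl
    exact (key x y hx hy l hl).1 (h x y (mul_pos hx hy) l hl)
  · intro h x y hxy l hl
    have hx : 0 < g x := pos_of_mul_pos_left hxy (zero_le)
    have hy : 0 < g y := pos_of_mul_pos_right hxy (zero_le)
    exact (key x y hx hy l hl).2 (h x y hx hy l hl)

/-- The superlevel set `{g ≥ t}`. -/
def superlevel (g : EuclideanSpace ℝ (Fin n) → ℝ≥0) (t : ℝ) : Set (EuclideanSpace ℝ (Fin n)) :=
  {x | t ≤ g x}

theorem superlevel_antitone : Antitone (superlevel g) := fun _ _ hst _ hx => le_trans hst hx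

theorem neg_superlevel (hg : ∀ x, g (-x) = g x) : -superlevel g t = superlevel g t := by
  ext x
  simp [superlevel, hg]

namespace IsAlphaConcave

theorem mem_superlevel {β : EReal} (hg : IsAlphaConcave β g) (ht : 0 < t) (hs : 0 < s)
    (hl : l ∈ Icc (0 : ℝ) 1) (hx : x ∈ superlevel g t) (hy : y ∈ superlevel g s) :
    (1 - l) • x + l • y ∈ superlevel g (realPowMean β l t s) :=
  (realPowMean.mono _ hl ht hs hx hy).trans
    (isAlphaConcave_iff.1 hg x y (ht.trans_le hx) (hs.trans_le hy) l hl)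

theorem convex_superlevel {β : EReal} (hg : IsAlphaConcave β g) (ht : 0 < t) :
    Convex ℝ (superlevel g t) := by
  intro x hx y hy a b ha hb hab
  have h := hg.mem_superlevel (l := b) ht ht ⟨hb, by linarith⟩ hx hy
  rwa [realPowMean.const _ ht, ← hab, add_sub_cancel_right] at h

/-- The origin is the midpoint of `x` and `-x`, where `g` takes equal values. The resulting bound
confines the layer-cake integral to a finite interval. -/
theorem le_apply_zero {β : EReal} (hg : IsAlphaConcave β g) (heven : ∀ x, g (-x) = g x)
    (x : EuclideanSpace ℝ (Fin n)) : g x ≤ g 0 := by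
  rcases eq_or_ne (g x) 0 with h | h
  · simp [h]
  · have hx : 0 < (g x : ℝ) := NNReal.coe_pos.2 (pos_iff_ne_zero.2 h)
    have h2 := isAlphaConcave_iff.1 hg x (-x) hx (by rwa [heven]) (1 / 2) (by norm_num)
    rw [heven, realPowMean.const _ hx] at h2
    norm_num at h2
    exact h2

/-- The closure is needed because `g` need not be upper semicontinuous. -/
theorem isSymmConvexBody_closure {β : EReal} (hg : IsAlphaConcave β g)
    (heven : ∀ x, g (-x) = g x) (hK : IsSymmConvexBody K) (ht : 0 < t)
    (hvol : volume (K ∩ superlevel g t) ≠ 0) :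
    IsSymmConvexBody (closure (K ∩ superlevel g t)) := by
  have hconv := hK.convex.inter (hg.convex_superlevel ht)
  refine ⟨hK.isCompact.closure_of_subset inter_subset_left, hconv.closure, ?_, ?_⟩
  · exact (hconv.interior_nonempty_of_volume_ne_zero hvol).mono (interior_mono subset_closure)
  · rw [neg_closure, inter_neg, hK.neg_eq, neg_superlevel heven]

theorem superlevel_volume_le (hlog : LogBrunnMinkowski n) (hn : 0 < n)
    (hg : IsAlphaConcave (α : EReal) g) (heven : ∀ x, g (-x) = g x)
    (hK : IsSymmConvexBody K) (hL : IsSymmConvexBody L) (hp : p ∈ Icc (0 : ℝ) 1)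
    (hl : l ∈ Icc (0 : ℝ) 1) (ht : 0 < t) (hs : 0 < s)
    (htK : volume (K ∩ superlevel g t) ≠ 0) (hsL : volume (L ∩ superlevel g s) ≠ 0) :
    ENNReal.ofReal (realPowMean ((p / n : ℝ) : EReal) l (volume (K ∩ superlevel g t)).toReal
        (volume (L ∩ superlevel g s)).toReal)
      ≤ volume (lpComb p l K L ∩ superlevel g (realPowMean (α : EReal) l t s)) := by
  have hKt := hg.isSymmConvexBody_closure heven hK ht htK
  have hLs := hg.isSymmConvexBody_closure heven hL hs hsL
  have hsub : ∀ {A S : Set (EuclideanSpace ℝ (Fin n))}, IsSymmConvexBody A →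
      closure (A ∩ S) ⊆ A := fun hA =>
    closure_minimal inter_subset_left hA.isCompact.isClosed
  have hle : ∀ {A : Set (EuclideanSpace ℝ (Fin n))} {w : ℝ}, 0 < w → IsSymmConvexBody A →
      volume (A ∩ superlevel g w) ≠ 0 → IsSymmConvexBody (closure (A ∩ superlevel g w)) →
      0 < (volume (A ∩ superlevel g w)).toReal ∧
      (volume (A ∩ superlevel g w)).toReal ≤ (volume (closure (A ∩ superlevel g w))).toReal :=
    fun hw hA h0 hcl =>
      ⟨ENNReal.toReal_pos h0 (measure_ne_top_of_subset inter_subset_left hA.volume_ne_top),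
        ENNReal.toReal_mono hcl.volume_ne_top (measure_mono subset_closure)⟩
  obtain ⟨h1, h2⟩ := hle ht hK htK hKt
  obtain ⟨h3, h4⟩ := hle hs hL hsL hLs
  refine (ENNReal.ofReal_le_ofReal (realPowMean.mono _ hl h1 h3 h2 h4)).trans
    ((hlog.lp hn hp.1 hl hKt hLs).trans (le_trans (measure_mono ?_)
      (hg.convex_superlevel (realPowMean.pos (α : EReal) hl ht hs)).volume_closure_inter_le))
  refine subset_inter (lpComb_mono hKt hLs hK hL hl (hsub hK) (hsub hL)) fun z hz => ?_
  obtain ⟨_, ⟨x, hx, rfl⟩, _, ⟨y, hy, rfl⟩, rfl⟩ := lpComb_subset_add hKt hLs hp hl hz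
  -- The two points are only limits of points of the slices, so their combination is only in the
  -- closure of the superlevel set; the excess is a null frontier.
  exact map_mem_closure₂ (f := fun x y : EuclideanSpace ℝ (Fin n) => (1 - l) • x + l • y)
    (by fun_prop) hx hy fun a ha b hb => hg.mem_superlevel ht hs hl ha.2 hb.2

end IsAlphaConcave

theorem withDensity_apply_eq_lintegral_superlevel (hg : AEMeasurable g volume)
    (hC : MeasurableSet C) :
    volume.withDensity (fun x => (g x : ℝ≥0∞)) C
      = ∫⁻ t in Ioi (0 : ℝ), volume (C ∩ superlevel g t) := by
  rw [withDensity_apply _ hC]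
  have h := lintegral_eq_lintegral_meas_le (volume.restrict C) (f := fun x => (g x : ℝ))
    (Filter.Eventually.of_forall fun x => NNReal.coe_nonneg _) hg.coe_nnreal_real.restrict
  simp only [ENNReal.ofReal_coe_nnreal] at h
  rw [h]
  simp only [Measure.restrict_apply' hC, superlevel, inter_comm]

theorem antitone_volume_superlevel (hC : volume C ≠ ⊤) :
    Antitone fun t => (volume (C ∩ superlevel g t)).toReal := fun _ _ hst =>
  ENNReal.toReal_mono (measure_ne_top_of_subset inter_subset_left hC)
    (measure_mono (inter_subset_inter_right _ (superlevel_antitone hst)))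

theorem ofReal_integral_superlevel (hC : volume C ≠ ⊤) {R : ℝ} (hR : 0 ≤ R) :
    ENNReal.ofReal (∫ t in (0 : ℝ)..R, (volume (C ∩ superlevel g t)).toReal)
      = ∫⁻ t in Ioc 0 R, volume (C ∩ superlevel g t) := by
  rw [intervalIntegral.integral_of_le hR, ofReal_integral_eq_lintegral_ofReal
    ((antitone_volume_superlevel hC).intervalIntegrable (μ := volume) (a := 0) (b := R)).1
    (Filter.Eventually.of_forall fun x => ENNReal.toReal_nonneg)]
  simp only [ENNReal.ofReal_toReal (measure_ne_top_of_subset inter_subset_left hC)]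

theorem withDensity_apply_eq_ofReal_integral (hg : AEMeasurable g volume) (hC : MeasurableSet C)
    (hC' : volume C ≠ ⊤) {T : ℝ} (hT : 0 ≤ T) (hgT : ∀ x, (g x : ℝ) ≤ T) :
    volume.withDensity (fun x => (g x : ℝ≥0∞)) C
      = ENNReal.ofReal (∫ t in (0 : ℝ)..T, (volume (C ∩ superlevel g t)).toReal) := by
  rw [withDensity_apply_eq_lintegral_superlevel hg hC, ofReal_integral_superlevel hC' hT,
    ← Ioc_union_Ioi_eq_Ioi hT, lintegral_union measurableSet_Ioi (Ioc_disjoint_Ioi le_rfl),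
    setLIntegral_congr_fun (g := fun _ => 0) measurableSet_Ioi, lintegral_zero, add_zero]
  intro t ht
  have : superlevel g t = ∅ := eq_empty_of_forall_notMem fun x hx =>
    absurd (le_trans hx (hgT x)) (not_le.2 ht)
  simp [this]

theorem powMean_withDensity_le_of_even (hn : 0 < n) (hlog : LogBrunnMinkowski n)
    (hp : p ∈ Icc (0 : ℝ) 1) (hα : -(p / (n : ℝ)) ≤ α) (hα' : α ≤ 1)
    (hgm : AEMeasurable g volume) (hg : IsAlphaConcave (α : EReal) g)
    (heven : ∀ x, g (-x) = g x) (hK : IsSymmConvexBody K) (hL : IsSymmConvexBody L)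
    (hl : l ∈ Icc (0 : ℝ) 1) :
    powMean (concExponent n p α) l (volume.withDensity (fun x => (g x : ℝ≥0∞)) K)
        (volume.withDensity (fun x => (g x : ℝ≥0∞)) L)
      ≤ volume.withDensity (fun x => (g x : ℝ≥0∞)) (lpComb p l K L) := by
  obtain ⟨T, hT0, hgT⟩ : ∃ T : ℝ, 0 ≤ T ∧ ∀ x, (g x : ℝ) ≤ T :=
    ⟨g 0, NNReal.coe_nonneg _, fun x => hg.le_apply_zero heven x⟩
  set C := lpComb p l K L with hC
  have hCvol : volume C ≠ ⊤ := measure_ne_top_of_subset (lpComb_subset_add hK hL hp hl)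
    ((hK.isCompact.smul (1 - l)).add (hL.isCompact.smul l)).measure_lt_top.ne
  set φ : ℝ → ℝ := fun t => (volume (K ∩ superlevel g t)).toReal with hφdef
  set ψ : ℝ → ℝ := fun t => (volume (L ∩ superlevel g t)).toReal with hψdef
  set h : ℝ → ℝ := fun t => (volume (C ∩ superlevel g t)).toReal with hhdef
  have hφ : Antitone φ := antitone_volume_superlevel hK.volume_ne_top
  have hψ : Antitone ψ := antitone_volume_superlevel hL.volume_ne_top
  have hh : Antitone h := antitone_volume_superlevel hCvol
  rw [withDensity_apply_eq_ofReal_integral hgm hK.isCompact.measurableSet hK.volume_ne_top hT0 hgT,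
    withDensity_apply_eq_ofReal_integral hgm hL.isCompact.measurableSet hL.volume_ne_top hT0 hgT]
  -- If some positive level has positive volume, the origin is interior to that superlevel set and
  -- to both bodies, so both masses are positive. Otherwise both vanish.
  by_cases hpos : ∃ t, 0 < t ∧ volume (superlevel g t) ≠ 0
  · obtain ⟨t, ht, hvt⟩ := hpos
    have hint : ∀ {M : Set (EuclideanSpace ℝ (Fin n))}, IsSymmConvexBody M →
        0 < ∫ s in (0 : ℝ)..T, (volume (M ∩ superlevel g s)).toReal := by
      intro M hM
      have h0 : (0 : EuclideanSpace ℝ (Fin n)) ∈ interior (superlevel g t) :=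
        (hg.convex_superlevel ht).zero_mem_interior_of_neg_eq (neg_superlevel heven)
          ((hg.convex_superlevel ht).interior_nonempty_of_volume_ne_zero hvt)
      have h0' : (0 : EuclideanSpace ℝ (Fin n)) ∈ superlevel g t := interior_subset h0
      have htT : t ≤ T := le_trans h0' (hgT 0)
      have hne : (interior (M ∩ superlevel g t)).Nonempty :=
        ⟨0, by rw [interior_inter]; exact ⟨hM.zero_mem_interior, h0⟩⟩
      have hvol : 0 < (volume (M ∩ superlevel g t)).toReal :=
        ENNReal.toReal_pos (Measure.measure_pos_of_nonempty_interior _ hne).ne'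
          (measure_ne_top_of_subset inter_subset_left hM.volume_ne_top)
      have hanti := antitone_volume_superlevel (g := g) hM.volume_ne_top
      have h1 := hanti.intervalIntegral_add 0 t T
      have h2 := hanti.mul_sub_le_intervalIntegral ht.le
      have h3 := hanti.mul_sub_le_intervalIntegral htT
      have h4 := mul_nonneg (ENNReal.toReal_nonneg (a := volume (M ∩ superlevel g T)))
        (sub_nonneg.2 htT)
      have h5 := mul_pos hvol (sub_pos.2 ht)
      linarith
    have hA := hint hK
    have hB := hint hL
    rw [realPowMean.ofReal_eq _ hl hA hB]
    -- The one-dimensional inequality needs φ and ψ positive at the endpoints, so each is cut off at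
    -- the fraction `θ` of its mass. Homogeneity extracts `θ`, which then tends to 1.
    have key : ∀ θ ∈ Ioo (0 : ℝ) 1, ENNReal.ofReal (θ * realPowMean (concExponent n p α) l
        (∫ s in (0 : ℝ)..T, φ s) (∫ s in (0 : ℝ)..T, ψ s))
          ≤ volume.withDensity (fun x => (g x : ℝ≥0∞)) C := by
      intro θ hθ
      obtain ⟨τ, hτ, hφτ, hτA⟩ := hφ.exists_intervalIntegral_eq_mul
        (fun _ => ENNReal.toReal_nonneg) hT0 hA hθ
      obtain ⟨σ, hσ, hψσ, hσB⟩ := hψ.exists_intervalIntegral_eq_mul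
        (fun _ => ENNReal.toReal_nonneg) hT0 hB hθ
      have hmain := realPowMean_integral_le_integral hn hp.1 hα hα' hl hφ hψ hh
        (fun _ => ENNReal.toReal_nonneg) (fun _ => ENNReal.toReal_nonneg)
        (fun _ => ENNReal.toReal_nonneg) (fun t s ht hs hφt hψs => by
          refine (ENNReal.ofReal_le_iff_le_toReal
            (measure_ne_top_of_subset inter_subset_left hCvol)).1 ?_
          exact hg.superlevel_volume_le hlog hn heven hK hL hp hl ht hs
            (ENNReal.toReal_pos_iff.1 hφt).1.ne' (ENNReal.toReal_pos_iff.1 hψs).1.ne')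
        hτ hσ hφτ hψσ
      rw [hτA, hσB, realPowMean.smul _ hl hθ.1 hA hB] at hmain
      refine (ENNReal.ofReal_le_ofReal hmain).trans ?_
      rw [ofReal_integral_superlevel hCvol (realPowMean.pos _ hl hτ hσ).le,
        withDensity_apply_eq_lintegral_superlevel hgm isClosed_lpComb.measurableSet]
      exact lintegral_mono_set Ioc_subset_Ioi_self
    have hlim : Filter.Tendsto (fun θ : ℝ => ENNReal.ofReal (θ * realPowMean (concExponent n p α) l
        (∫ s in (0 : ℝ)..T, φ s) (∫ s in (0 : ℝ)..T, ψ s))) (nhdsWithin 1 (Iio 1))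
        (nhds (ENNReal.ofReal (1 * realPowMean (concExponent n p α) l
          (∫ s in (0 : ℝ)..T, φ s) (∫ s in (0 : ℝ)..T, ψ s)))) :=
      ((ENNReal.continuous_ofReal.comp (by fun_prop)).tendsto 1).mono_left nhdsWithin_le_nhds
    rw [one_mul] at hlim
    exact le_of_tendsto hlim (Filter.eventually_of_mem (Ioo_mem_nhdsLT one_pos) key)
  · push Not at hpos
    have hzero : ∀ M : Set (EuclideanSpace ℝ (Fin n)),
        ∫ s in (0 : ℝ)..T, (volume (M ∩ superlevel g s)).toReal = 0 := by
      intro M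
      rw [intervalIntegral.integral_of_le hT0]
      refine setIntegral_eq_zero_of_forall_eq_zero fun s hs => ?_
      rw [measure_mono_null inter_subset_right (hpos s hs.1), ENNReal.toReal_zero]
    rw [hzero, hzero, ENNReal.ofReal_zero, powMean_zero_zero _ hl]
    exact zero_le

/-! ### Symmetrization of the density. -/

theorem IsAlphaConcave.min_neg {β : EReal} (hf : IsAlphaConcave β f) :
    IsAlphaConcave β fun x => min (f x) (f (-x)) := by
  rw [isAlphaConcave_iff] at hf ⊢
  intro x y hx hy l hl
  simp only [NNReal.coe_min] at hx hy ⊢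
  obtain ⟨hx1, hx2⟩ := lt_min_iff.1 hx
  obtain ⟨hy1, hy2⟩ := lt_min_iff.1 hy
  refine le_min ((realPowMean.mono _ hl hx hy (min_le_left _ _) (min_le_left _ _)).trans
    (hf x y hx1 hy1 l hl)) ?_
  have h := (realPowMean.mono _ hl hx hy (min_le_right _ _) (min_le_right _ _)).trans
    (hf (-x) (-y) hx2 hy2 l hl)
  rwa [smul_neg, smul_neg, ← neg_add] at h

/-- The reflected density defines the reflected measure, and a density is determined almost
everywhere by its measure. -/
theorem ae_eq_comp_neg_of_isNegInvariant (hfm : AEMeasurable f volume)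
    (hsymm : (volume.withDensity fun x => (f x : ℝ≥0∞)).IsNegInvariant) :
    ∀ᵐ x, f x = f (-x) := by
  have hneg := Measure.measurePreserving_neg (volume : Measure (EuclideanSpace ℝ (Fin n)))
  have h := (withDensity_eq_iff_of_sigmaFinite (μ := volume) hfm.coe_nnreal_ennreal
    (g := fun x => (f (-x) : ℝ≥0∞))
    (hfm.comp_quasiMeasurePreserving hneg.quasiMeasurePreserving).coe_nnreal_ennreal).1 ?_
  · filter_upwards [h] with x hx
    exact_mod_cast hx
  · ext s hs
    rw [← Measure.measure_neg (volume.withDensity fun x => (f x : ℝ≥0∞)) s,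
      withDensity_apply _ hs.neg, withDensity_apply _ hs]
    have := hneg.setLIntegral_comp_preimage_emb (MeasurableEquiv.neg _).measurableEmbedding
      (fun x => (f x : ℝ≥0∞)) (-s)
    rw [← this]
    simp

end Superlevel

theorem theorem3p3 (n : ℕ) (hn : 0 < n) (hlog : LogBrunnMinkowski n)
    (p : ℝ) (hp : p ∈ Icc (0 : ℝ) 1)
    (α : ℝ) (hα : -(p / (n : ℝ)) ≤ α) (hα' : α ≤ 1)
    (μ : Measure (EuclideanSpace ℝ (Fin n))) (hμsymm : μ.IsNegInvariant)
    (f : EuclideanSpace ℝ (Fin n) → ℝ≥0) (hfm : AEMeasurable f volume)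
    (hf : IsAlphaConcave (α : EReal) f)
    (hμ : μ = volume.withDensity (fun x => (f x : ℝ≥0∞)))
    (K L : Set (EuclideanSpace ℝ (Fin n))) (hK : IsSymmConvexBody K) (hL : IsSymmConvexBody L)
    (l : ℝ) (hl : l ∈ Icc (0 : ℝ) 1) :
    powMean (concExponent n p α) l (μ K) (μ L) ≤ μ (lpComb p l K L) := by
  subst hμ
  have hae := ae_eq_comp_neg_of_isNegInvariant hfm hμsymm
  have hneg := Measure.measurePreserving_neg (volume : Measure (EuclideanSpace ℝ (Fin n)))
  have hdens : volume.withDensity (fun x => (f x : ℝ≥0∞))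
      = volume.withDensity (fun x => ((min (f x) (f (-x)) : ℝ≥0) : ℝ≥0∞)) := by
    refine withDensity_congr_ae ?_
    filter_upwards [hae] with x hx
    rw [← hx, min_self]
  rw [hdens]
  exact powMean_withDensity_le_of_even hn hlog hp hα hα'
    (hfm.min (hfm.comp_quasiMeasurePreserving hneg.quasiMeasurePreserving)) hf.min_neg
    (fun x => by rw [neg_neg, min_comm]) hK hL hl
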